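/- Let $n\ge 0$, $q\ge 1$ and $m\ge 1$ be integers and let $K$ be a field such that $n!\,q$ is invertible in $K$ and $K$ contains a primitive $q$-th root of $1$. Let $G=G(n,q)\le GL(n,K)$ be the group of all monomial matrices (exactly one non-zero entry in each row and each column) whose non-zero entries are $q$-th roots of $1$. It acts on $V=K^n$ and diagonally on $V^m=V\oplus\cdots\oplus V$, and hence on the coordinate ring $K[V^m]$, the polynomial ring over $K$ in the $mn$ variables $x(i)_j$ ($1\le i\le m$, $1\le j\le n$), where $x(i)_j$ is the $j$-th coordinate of the $i$-th vector. Let $J_m(q)$ be the Hilbert ideal, that is, the ideal of $K[V^m]$ generated by the homogeneous $G$-invariant polynomials of positive degree, and let $\tau_G(V^m)$ be the minimal natural number $d$ such that all homogeneous elements of $K[V^m]$ of degree at least $d$ belong to $J_m(q)$. Then every homogeneous polynomial in $K[V^m]$ of degree at least $1+\sum_{j=1}^n(qj-1)$ lies in $J_m(q)$, and some homogeneous polynomial of degree $\sum_{j=1}^n(qj-1)$ does not lie in $J_m(q)$. Consequently $$\tau_{G(n,q)}(V^m)=1+\sum_{j=1}^n(qj-1).$$ -/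

import Mathlib

noncomputable section

namespace VectorInvariants

/-- The group `G(n,q)`: the subgroup of `GL(n,K)` of all monomial matrices whose non-zero entries
are `q`-th roots of `1`. The matrix attached to a permutation `σ` and a tuple `ε` of `q`-th roots
of unity has the entry `ε j` at position `(σ j, j)`, for each `j`, and zeros elsewhere. -/
def monomialGroup (K : Type*) [Field K] (n q : ℕ) : Subgroup (GL (Fin n) K) where
  carrier := {g | ∃ (σ : Equiv.Perm (Fin n)) (ε : Fin n → Kˣ), (∀ j, ε j ^ q = 1) ∧
    ∀ i j, (g : Matrix (Fin n) (Fin n) K) i j = if i = σ j then (ε j : K) else 0}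
  one_mem' := ⟨1, fun _ => 1, by simp, by
    intro i j
    rw [Units.val_one, Matrix.one_apply, Equiv.Perm.one_apply, Units.val_one]⟩
  mul_mem' := by
    rintro g h ⟨σ, ε, hε, hg⟩ ⟨τ, δ, hδ, hh⟩
    refine ⟨σ * τ, fun j => ε (τ j) * δ j, fun j => by rw [mul_pow, hε, hδ, one_mul], ?_⟩
    intro i j
    rw [Units.val_mul, Matrix.mul_apply]
    simp only [hg, hh, mul_ite, mul_zero, Finset.sum_ite_eq', Finset.mem_univ,
      if_true, ite_mul, zero_mul, Equiv.Perm.mul_apply, Units.val_mul]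
    congr
  inv_mem' := by
    rintro g ⟨σ, ε, hε, hg⟩
    refine ⟨σ⁻¹, fun j => (ε (σ⁻¹ j))⁻¹, fun j => by rw [inv_pow, hε, inv_one], ?_⟩
    have key : (g : Matrix (Fin n) (Fin n) K) *
        (Matrix.of fun i j => if i = σ⁻¹ j then (((ε (σ⁻¹ j))⁻¹ : Kˣ) : K) else 0) = 1 := by
      ext i j
      rw [Matrix.mul_apply]
      simp only [hg, Matrix.of_apply, mul_ite, mul_zero, Finset.sum_ite_eq',
        Finset.mem_univ, if_true, ite_mul, zero_mul, Units.mul_inv,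
        Matrix.one_apply]
      have hs : σ (σ⁻¹ j) = j := σ.apply_symm_apply j
      rw [hs]
    intro i j
    have h2 := congrArg (fun M => ((g⁻¹ : GL (Fin n) K) : Matrix (Fin n) (Fin n) K) * M) key
    simp only [← mul_assoc, ← Units.val_mul, inv_mul_cancel, Units.val_one, one_mul, mul_one] at h2
    rw [← h2, Matrix.of_apply]

variable {K : Type*} [Field K] {n : ℕ}

/-- The coordinate ring `K[V^m]` of `V^m`, where `V = K^n`: the polynomial ring in the `mn`
variables `X (i, j)`, where `X (i, j)` is the `j`-th coordinate of the `i`-th vector. -/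
abbrev CoordRing (K : Type*) [Field K] (n m : ℕ) : Type _ := MvPolynomial (Fin m × Fin n) K

/-- The map `f ↦ f ∘ g` on `K[V^m]`, where `g` acts diagonally on `V^m`: it substitutes for each
coordinate function `X (i, j)` the `j`-th coordinate of `g` applied to the `i`-th vector. -/
def pullback (m : ℕ) (g : GL (Fin n) K) : CoordRing K n m →ₐ[K] CoordRing K n m :=
  MvPolynomial.aeval fun p : Fin m × Fin n =>
    ∑ k : Fin n, MvPolynomial.C ((g : Matrix (Fin n) (Fin n) K) p.2 k) * MvPolynomial.X (p.1, k)

/-- `f ∈ K[V^m]^G`. -/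
def IsInvariant (G : Subgroup (GL (Fin n) K)) {m : ℕ} (f : CoordRing K n m) : Prop :=
  ∀ g ∈ G, pullback m g f = f

/-- The Hilbert ideal: the ideal of `K[V^m]` generated by the homogeneous `G`-invariants of
positive degree. -/
def hilbertIdeal (G : Subgroup (GL (Fin n) K)) (m : ℕ) : Ideal (CoordRing K n m) :=
  Ideal.span {f | IsInvariant G f ∧ ∃ d : ℕ, 0 < d ∧ f.IsHomogeneous d}

/-- `τ_G(V^m)`: the minimal natural number `d` such that all homogeneous elements of `K[V^m]` of
degree at least `d` belong to the Hilbert ideal. -/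
def tau (G : Subgroup (GL (Fin n) K)) (m : ℕ) : ℕ :=
  sInf {d : ℕ | ∀ e : ℕ, d ≤ e → ∀ f : CoordRing K n m, f.IsHomogeneous e → f ∈ hilbertIdeal G m}

end VectorInvariants

end

/-!
Write `x_j` for the `j`-th block of variables `x(1)_j, …, x(m)_j`, with blocks numbered from `0`.

*Upper bound.* If `u` is a homogeneous polynomial of degree `q` in `m` variables, then `G(n,q)`
permutes `u(x_0), …, u(x_{n-1})`, because the `q`-th roots of unity drop out
(`pullback_blockEval`). Hence their elementary symmetric functions of positive degree lie in the
Hilbert ideal. Comparing generating functions, so does the complete homogeneous symmetric function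
of degree `n - j` in `u(x_0), …, u(x_j)` (`sum_finsuppAntidiag_prod_pow_eq_zero`). This rewrites
`u(x_j) ^ (n - j)` in terms of products that involve `x_j` less and earlier blocks more
(`blockEval_pow_mul_mem`). As `n!` is invertible, every product of `n - j` monomials of degree `q`
is a combination of `(n - j)`-th powers (`factorial_smul_prod_eq_sum_pow`), so every monomial of
degree at least `q (n - j)` in `x_j` can be rewritten. The total degree is preserved and the weight
`∑ j, j * deg_j` drops, so the rewriting stops, and it can only stop at monomials of degree
less than `q (n - j)` in each `x_j`. A monomial of total degree more than `∑ j, (q (n - j) - 1)`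
never becomes such a monomial, and therefore lies in the ideal (`monomial_mem_hilbertIdeal`).

*Lower bound.* Consider the linear functional that takes the alternating sum, over permutations
`σ`, of the coefficients at `∏ j, x(i₀)_j ^ (q (σ j + 1) - 1)`. For an invariant `h` of positive
degree and a monomial `x ^ a`, a non-zero summand for `x ^ a * h` forces the exponents of `a` to be
congruent to `-1` modulo `q` and two of them to coincide (`exists_ne_of_lt_staircase`); the
corresponding transposition then cancels the summands in pairs. So the functional vanishes on the
Hilbert ideal, while it takes the value `1` at the monomial with `σ = 1`, whose degree is
`∑ j, (q (j + 1) - 1)`.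
-/

namespace VectorInvariants

open MvPolynomial

/-! ### Symmetric functions in a commutative ring -/

/-- If all elementary symmetric functions of `a` of positive degree vanish, then so does the
complete homogeneous symmetric function of degree `n - j` in the first elements `a i`, `i ≤ j`,
since its generating function `∏_{i ≤ j} (1 - a i T)⁻¹` is then `∏_{i > j} (1 - a i T)`. -/
theorem sum_finsuppAntidiag_prod_pow_eq_zero {A : Type*} [CommRing A] {n : ℕ} (a : Fin n → A)
    (ha : ∀ r, 0 < r → ∑ S ∈ Finset.powersetCard r (Finset.univ : Finset (Fin n)),
      ∏ i ∈ S, a i = 0) (j : Fin n) :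
    ∑ r ∈ Finset.finsuppAntidiag (Finset.Iic j) (n - j), ∏ i ∈ Finset.Iic j, a i ^ r i = 0 := by
  have hprod : ∏ i, (1 - Polynomial.C (a i) * Polynomial.X) = 1 := by
    have h1 : ∏ i, (1 - Polynomial.C (a i) * Polynomial.X) =
        ∑ S ∈ (Finset.univ : Finset (Fin n)).powerset,
          Polynomial.C (∏ i ∈ S, a i) * (-Polynomial.X) ^ S.card := by
      simp_rw [sub_eq_add_neg, Finset.prod_one_add, ← mul_neg, Finset.prod_mul_distrib,
        Finset.prod_const, map_prod]
    rw [h1, Finset.sum_powerset, Finset.sum_range_succ', Finset.sum_eq_zero, zero_add]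
    · simp
    · intro r _
      have h2 : ∀ S ∈ Finset.powersetCard (r + 1) (Finset.univ : Finset (Fin n)),
          Polynomial.C (∏ i ∈ S, a i) * (-Polynomial.X) ^ S.card =
          Polynomial.C (∏ i ∈ S, a i) * (-Polynomial.X) ^ (r + 1) := by
        intro S hS
        rw [(Finset.mem_powersetCard.1 hS).2]
      rw [Finset.sum_congr rfl h2, ← Finset.sum_mul, ← map_sum, ha _ r.succ_pos, map_zero, zero_mul]
  -- The geometric series, the inverse of `1 - a i T`.
  let g : Fin n → PowerSeries A := fun i => PowerSeries.mk fun r => a i ^ r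
  have hg : ∀ i, g i * (1 - PowerSeries.C (a i) * PowerSeries.X) = 1 := by
    intro i
    ext r
    rw [mul_sub, mul_one, mul_left_comm, map_sub, PowerSeries.coeff_C_mul]
    cases r with
    | zero => simp [g]
    | succ r => simp [g, PowerSeries.coeff_succ_mul_X, PowerSeries.coeff_one, pow_succ']
  let Q : Polynomial A := ∏ i ∈ Finset.Ioi j, (1 - Polynomial.C (a i) * Polynomial.X)
  have hQ : ∏ i ∈ Finset.Iic j, g i = (Q : PowerSeries A) := by
    have h1 : (∏ i ∈ Finset.Iic j, (1 - PowerSeries.C (a i) * PowerSeries.X)) *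
        (Q : PowerSeries A) = 1 := by
      have h2 := congrArg (Polynomial.coeToPowerSeries.ringHom (R := A)) hprod
      have h3 : Finset.Ioi j = (Finset.Iic j)ᶜ := by ext i; simp
      rw [← Finset.prod_mul_prod_compl (Finset.Iic j), ← h3, map_mul, map_one, map_prod] at h2
      have hQ' : (Q : PowerSeries A) = Polynomial.coeToPowerSeries.ringHom Q := rfl
      rw [hQ', map_prod]
      simpa using h2
    calc ∏ i ∈ Finset.Iic j, g i
        = (∏ i ∈ Finset.Iic j, g i * (1 - PowerSeries.C (a i) * PowerSeries.X)) *
            (Q : PowerSeries A) := by rw [Finset.prod_mul_distrib, mul_assoc, h1, mul_one]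
      _ = Q := by rw [Finset.prod_eq_one fun i _ => hg i, one_mul]
  have hcoeff := congrArg (PowerSeries.coeff (n - j)) hQ
  rw [PowerSeries.coeff_prod, Polynomial.coeff_coe, Polynomial.coeff_eq_zero_of_natDegree_lt]
    at hcoeff
  · simpa [g] using hcoeff
  · calc Q.natDegree ≤ ∑ i ∈ Finset.Ioi j, (1 - Polynomial.C (a i) * Polynomial.X).natDegree :=
          Polynomial.natDegree_prod_le _ _
      _ ≤ ∑ i ∈ Finset.Ioi j, 1 := by
          refine Finset.sum_le_sum fun i _ => ?_
          compute_degree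
      _ < n - j := by
          have := j.2
          simp only [Finset.sum_const, Fin.card_Ioi, smul_eq_mul]
          omega

/-- Polarization: `k!` times a product of `k` elements is a signed sum of `k`-th powers of
subsums. -/
theorem factorial_smul_prod_eq_sum_pow {A : Type*} [CommRing A] {k : ℕ} (p : Fin k → A) :
    (k.factorial : A) * ∏ i, p i =
      ∑ S : Finset (Fin k), (-1) ^ (Finset.univ \ S).card * (∑ i ∈ S, p i) ^ k := by
  classical
  have hsign : ∀ φ : Fin k → Fin k,
      ∑ S : Finset (Fin k), (-1 : A) ^ (Finset.univ \ S).card * (if ∀ l, φ l ∈ S then 1 else 0) =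
        if Function.Bijective φ then 1 else 0 := by
    intro φ
    have h1 := Finset.prod_add (fun _ : Fin k => (1 : A))
      (fun i => if i ∈ Set.range φ then 0 else -1) Finset.univ
    have h2 : ∏ i : Fin k, ((1 : A) + if i ∈ Set.range φ then 0 else -1) =
        if Function.Bijective φ then 1 else 0 := by
      simp only [← Finite.surjective_iff_bijective]
      split_ifs with h
      · exact Finset.prod_eq_one fun i _ => (by
          rw [if_pos (Set.mem_range.2 (h i)), add_zero])
      · obtain ⟨i, hi⟩ := not_forall.1 h
        exact Finset.prod_eq_zero (Finset.mem_univ i) (by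
          rw [if_neg (by simpa using hi), add_neg_cancel])
    rw [← h2, h1, Finset.powerset_univ]
    refine Finset.sum_congr rfl fun S _ => ?_
    rw [Finset.prod_const_one, one_mul]
    split_ifs with h
    · rw [mul_one, ← Finset.prod_const]
      refine (Finset.prod_congr rfl fun i hi => if_neg ?_).symm
      rintro ⟨l, rfl⟩
      exact (Finset.mem_sdiff.1 hi).2 (h l)
    · obtain ⟨l, hl⟩ := not_forall.1 h
      rw [mul_zero]
      refine (Finset.prod_eq_zero (Finset.mem_sdiff.2 ⟨Finset.mem_univ (φ l), hl⟩) ?_).symm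
      exact if_pos ⟨l, rfl⟩
  have hpow : ∀ S : Finset (Fin k), (∑ i ∈ S, p i) ^ k =
      ∑ φ : Fin k → Fin k, (if ∀ l, φ l ∈ S then 1 else 0) * ∏ l, p (φ l) := by
    intro S
    rw [Finset.sum_pow']
    simp_rw [ite_mul, one_mul, zero_mul]
    rw [← Finset.sum_filter]
    refine Finset.sum_congr ?_ fun _ _ => rfl
    ext φ
    simp [Fintype.mem_piFinset]
  simp_rw [hpow, Finset.mul_sum, ← mul_assoc]
  rw [Finset.sum_comm]
  simp_rw [← Finset.sum_mul, hsign, ite_mul, one_mul, zero_mul]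
  rw [← Finset.sum_filter]
  have hconst : ∀ φ ∈ Finset.univ.filter (Function.Bijective (α := Fin k) (β := Fin k)),
      ∏ l, p (φ l) = ∏ i, p i := by
    intro φ hφ
    exact Function.Bijective.prod_comp (Finset.mem_filter.1 hφ).2 p
  rw [Finset.sum_congr rfl hconst, Finset.sum_const, nsmul_eq_mul]
  congr 2
  rw [← Fintype.card_subtype, ← Fintype.card_congr (Equiv.ofBijective
    (fun e : Equiv.Perm (Fin k) => (⟨e, e.bijective⟩ : {φ : Fin k → Fin k // Function.Bijective φ}))
    ⟨fun e f h => by ext1 x; exact congrFun (congrArg Subtype.val h) x,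
      fun φ => ⟨Equiv.ofBijective φ.1 φ.2, rfl⟩⟩), Fintype.card_perm, Fintype.card_fin]

/-! ### Invariants from homogeneous polynomials of degree `q` -/

variable {K : Type*} [Field K] {n : ℕ}

/-- The polynomial function `u(x_j)` of the `j`-th block of variables, when `u` is a polynomial in
`m` variables. -/
noncomputable def blockEval {m : ℕ} (j : Fin n) : MvPolynomial (Fin m) K →ₐ[K] CoordRing K n m :=
  rename fun i => (i, j)

theorem weight_mapDomain_block {m : ℕ} (v : Fin n → ℕ) (j : Fin n) (a : Fin m →₀ ℕ) :
    Finsupp.weight (fun p : Fin m × Fin n => v p.2) (a.mapDomain fun i => (i, j)) =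
      a.degree * v j := by
  rw [Finsupp.weight_apply, Finsupp.sum_mapDomain_index (by simp) (by intros; simp [add_mul]),
    Finsupp.degree_apply, Finset.sum_mul]
  rfl

theorem isWeightedHomogeneous_blockEval {m d : ℕ} (v : Fin n → ℕ) (j : Fin n)
    {u : MvPolynomial (Fin m) K} (hu : u.IsHomogeneous d) :
    (blockEval j u).IsWeightedHomogeneous (fun p : Fin m × Fin n => v p.2) (d * v j) := by
  rw [u.as_sum, map_sum]
  refine IsWeightedHomogeneous.sum _ _ _ fun a ha => ?_
  rw [blockEval, rename_monomial]
  apply isWeightedHomogeneous_monomial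
  rw [weight_mapDomain_block, Finsupp.degree_eq_weight_one]
  exact congrArg (· * v j) (hu (mem_support_iff.1 ha))

theorem pullback_blockEval {m q : ℕ} {g : GL (Fin n) K} {σ : Equiv.Perm (Fin n)} {ε : Fin n → Kˣ}
    (hε : ∀ j, ε j ^ q = 1)
    (hg : ∀ i j, (g : Matrix (Fin n) (Fin n) K) i j = if i = σ j then (ε j : K) else 0)
    {u : MvPolynomial (Fin m) K} (hu : u.IsHomogeneous q) (j : Fin n) :
    pullback m g (blockEval (σ j) u) = blockEval j u := by
  have hX : ∀ i, pullback m g (X (i, σ j)) = C (ε j : K) * X (i, j) := by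
    intro i
    rw [pullback, aeval_X, Finset.sum_eq_single j]
    · rw [hg, if_pos rfl]
    · intro k _ hk
      rw [hg, if_neg (fun h => hk (σ.injective h).symm), C_0, zero_mul]
    · simp
  rw [u.as_sum]
  simp only [map_sum]
  refine Finset.sum_congr rfl fun a ha => ?_
  have h : a.degree = q := by
    rw [Finsupp.degree_eq_weight_one]
    exact hu (mem_support_iff.1 ha)
  rw [monomial_eq, Finsupp.prod]
  simp only [map_mul, map_prod, map_pow, blockEval, rename_X, rename_C, hX, mul_pow,
    Finset.prod_mul_distrib, Finset.prod_pow_eq_pow_sum]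
  have h' : ∑ i ∈ a.support, a i = q := h
  rw [h', ← map_pow, ← Units.val_pow_eq_pow_val, hε, Units.val_one, map_one, one_mul,
    pullback, algHom_C]
  rfl

theorem sum_prod_blockEval_mem_hilbertIdeal {m q : ℕ} (hq : 0 < q) {u : MvPolynomial (Fin m) K}
    (hu : u.IsHomogeneous q) {r : ℕ} (hr : 0 < r) :
    ∑ S ∈ Finset.powersetCard r (Finset.univ : Finset (Fin n)), ∏ i ∈ S, blockEval i u ∈
      hilbertIdeal (monomialGroup K n q) m := by
  have h1 : ∑ S ∈ Finset.powersetCard r (Finset.univ : Finset (Fin n)), ∏ i ∈ S, blockEval i u =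
      aeval (fun i => blockEval (m := m) i u) (esymm (Fin n) K r) := by
    rw [esymm, map_sum]
    simp
  rw [h1]
  refine Ideal.subset_span ⟨?_, q * r, Nat.mul_pos hq hr, ?_⟩
  · rintro g ⟨σ, ε, hε, hg⟩
    conv_lhs => rw [← rename_esymm (Fin n) K r σ, aeval_rename, comp_aeval_apply]
    congr 2
    funext j
    exact pullback_blockEval hε hg hu j
  · rw [← h1]
    refine IsHomogeneous.sum _ _ _ fun S hS => ?_
    have h2 : ∀ i : Fin n, (blockEval (m := m) i u).IsHomogeneous q := fun i => by
      have := isWeightedHomogeneous_blockEval (fun _ => 1) i hu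
      rwa [mul_one] at this
    have h3 := IsHomogeneous.prod S _ _ fun i _ => h2 i
    rwa [Finset.sum_const, (Finset.mem_powersetCard.1 hS).2, smul_eq_mul, mul_comm] at h3

/-! ### High degree forces membership in the Hilbert ideal -/

theorem exists_sum_le_of_mul_le_degree {σ : Type*} (q k : ℕ) (c : σ →₀ ℕ) (h : q * k ≤ c.degree) :
    ∃ w : Fin k → σ →₀ ℕ, (∀ i, (w i).degree = q) ∧ ∑ i, w i ≤ c := by
  induction k generalizing c with
  | zero => exact ⟨fun _ => 0, fun i => i.elim0, by simp⟩
  | succ k ih =>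
    rw [mul_add, mul_one] at h
    obtain ⟨g, hgc, hg⟩ := Finsupp.exists_le_degree_eq c q (by omega)
    have hc : c = g + (c - g) := (add_tsub_cancel_of_le hgc).symm
    have hdeg : c.degree = g.degree + (c - g).degree := by rw [← map_add, ← hc]
    obtain ⟨w, hw, hwc⟩ := ih (c - g) (by omega)
    refine ⟨Fin.cons g w, fun i => Fin.cases hg hw i, ?_⟩
    rw [Fin.sum_univ_succ, hc]
    simpa using hwc

/-- Weighted homogeneity of degree `W`, where all variables of the `j`-th block have weight `j`. -/
abbrev IsBlockHomogeneous {m : ℕ} (f : CoordRing K n m) (W : ℕ) : Prop :=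
  f.IsWeightedHomogeneous (fun p : Fin m × Fin n => (p.2 : ℕ)) W

theorem mem_of_forall_monomial_mem {m d W : ℕ} {I : Ideal (CoordRing K n m)}
    (h : ∀ b : Fin m × Fin n →₀ ℕ, b.degree = d →
      Finsupp.weight (fun p : Fin m × Fin n => (p.2 : ℕ)) b = W →
      monomial b (1 : K) ∈ I)
    {f : CoordRing K n m} (hd : f.IsHomogeneous d) (hW : IsBlockHomogeneous f W) : f ∈ I := by
  rw [f.as_sum]
  refine Ideal.sum_mem _ fun b hb => ?_
  rw [← mul_one (coeff b f), ← C_mul_monomial]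
  refine Ideal.mul_mem_left _ _ (h b ?_ (hW (mem_support_iff.1 hb)))
  rw [Finsupp.degree_eq_weight_one]
  exact hd (mem_support_iff.1 hb)

theorem sum_mul_lt_of_mem_finsuppAntidiag {j : Fin n} {k : ℕ} {r : Fin n →₀ ℕ}
    (hr : r ∈ Finset.finsuppAntidiag (Finset.Iic j) k) (hne : r ≠ Finsupp.single j k) :
    ∑ i ∈ Finset.Iic j, r i * (i : ℕ) < k * j := by
  rw [Finset.mem_finsuppAntidiag] at hr
  obtain ⟨hsum, hsupp⟩ := hr
  rw [← hsum, Finset.sum_mul]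
  refine Finset.sum_lt_sum (fun i hi => Nat.mul_le_mul_left _ (Fin.le_def.1 (Finset.mem_Iic.1 hi))) ?_
  by_contra! hcon
  have hzero : ∀ i, i ≠ j → r i = 0 := by
    intro i hij
    by_cases hi : i ∈ Finset.Iic j
    · have hlt : (i : ℕ) < j := 
        Fin.lt_def.1 (lt_of_le_of_ne (Finset.mem_Iic.1 hi) hij)
      by_contra h0
      exact absurd (hcon i hi) (not_le.2 (Nat.mul_lt_mul_of_pos_left hlt (Nat.pos_of_ne_zero h0)))
    · exact Finsupp.notMem_support_iff.1 fun h => hi (hsupp h)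
  apply hne
  ext i
  by_cases hij : i = j
  · subst hij
    rw [Finsupp.single_eq_same, ← hsum]
    exact (Finset.sum_eq_single_of_mem _ (Finset.mem_Iic.2 le_rfl) fun l _ hl => hzero l hl).symm
  · rw [hzero i hij, Finsupp.single_eq_of_ne hij]

/-- The rewriting step. Modulo the Hilbert ideal `u(x_j) ^ (n - j)` is a combination of products
of the `u(x_i)`, `i ≤ j`, of the same degree and of smaller block weight. -/
theorem blockEval_pow_mul_mem {m q d W : ℕ} (hq : 0 < q) (j : Fin n)
    (ih : ∀ f : CoordRing K n m, ∀ W' < W, f.IsHomogeneous d → IsBlockHomogeneous f W' →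
      f ∈ hilbertIdeal (monomialGroup K n q) m)
    {u : MvPolynomial (Fin m) K} (hu : u.IsHomogeneous q) {b : Fin m × Fin n →₀ ℕ}
    (hd : q * (n - j) + b.degree = d)
    (hW : q * ((n - j) * j) + Finsupp.weight (fun p : Fin m × Fin n => (p.2 : ℕ)) b = W) :
    blockEval j u ^ (n - j : ℕ) * monomial b 1 ∈ hilbertIdeal (monomialGroup K n q) m := by
  set J := hilbertIdeal (monomialGroup K n q) m
  have hmem : ∑ r ∈ Finset.finsuppAntidiag (Finset.Iic j) (n - j),
      ∏ i ∈ Finset.Iic j, blockEval i u ^ r i ∈ J := by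
    rw [← Ideal.Quotient.eq_zero_iff_mem]
    have h := sum_finsuppAntidiag_prod_pow_eq_zero
      (fun i : Fin n => Ideal.Quotient.mk J (blockEval i u)) (fun r hr => by
        have := Ideal.Quotient.eq_zero_iff_mem.2
          (sum_prod_blockEval_mem_hilbertIdeal (n := n) hq hu hr)
        simpa only [map_sum, map_prod] using this) j
    simpa only [map_sum, map_prod, map_pow] using h
  have hsingle : Finsupp.single j (n - j : ℕ) ∈ Finset.finsuppAntidiag (Finset.Iic j) (n - j) := by
    rw [Finset.mem_finsuppAntidiag]
    refine ⟨?_, ?_⟩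
    · rw [Finset.sum_eq_single_of_mem j (Finset.mem_Iic.2 le_rfl)
        fun l _ hl => Finsupp.single_eq_of_ne hl, Finsupp.single_eq_same]
    · exact Finsupp.support_single_subset.trans (by simp)
  have hlead : ∏ i ∈ Finset.Iic j, blockEval (m := m) i u ^ (Finsupp.single j (n - j : ℕ)) i =
      blockEval j u ^ (n - j : ℕ) := by
    rw [Finset.prod_eq_single_of_mem j (Finset.mem_Iic.2 le_rfl), Finsupp.single_eq_same]
    intro l _ hl
    rw [Finsupp.single_eq_of_ne hl, pow_zero]
  rw [← Finset.add_sum_erase _ _ hsingle, hlead] at hmem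
  have hmem' := Ideal.mul_mem_right (monomial b 1) _ hmem
  rw [add_mul, Finset.sum_mul] at hmem'
  refine (Ideal.add_mem_iff_left _ (Ideal.sum_mem _ fun r hr => ?_)).1 hmem'
  obtain ⟨hne, hr⟩ := Finset.mem_erase.1 hr
  have hhom : ∀ v : Fin n → ℕ,
      (∏ i ∈ Finset.Iic j, blockEval (m := m) i u ^ r i).IsWeightedHomogeneous (fun p : Fin m × Fin n => v p.2) (q * ∑ i ∈ Finset.Iic j, r i * v i) := by
    intro v
    have h := IsWeightedHomogeneous.prod (Finset.Iic j) (fun i => blockEval (m := m) i u ^ r i) _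
      fun i _ => (isWeightedHomogeneous_blockEval v i hu).pow (r i)
    simpa only [smul_eq_mul, mul_left_comm _ q, ← Finset.mul_sum] using h
  have hlt := sum_mul_lt_of_mem_finsuppAntidiag hr hne
  refine ih _ (q * ∑ i ∈ Finset.Iic j, r i * (i : ℕ) +
    Finsupp.weight (fun p : Fin m × Fin n => (p.2 : ℕ)) b) ?_ ?_ ?_
  · have := Nat.mul_lt_mul_of_pos_left hlt hq
    omega
  · have h := (hhom fun _ => 1).mul (isWeightedHomogeneous_monomial
      (fun _ : Fin m × Fin n => (1 : ℕ)) b (1 : K) rfl)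
    have hb : Finsupp.weight (fun _ : Fin m × Fin n => (1 : ℕ)) b = b.degree := by
      rw [Finsupp.degree_eq_weight_one]
    simp only [mul_one, (Finset.mem_finsuppAntidiag.1 hr).1, hb] at h
    exact hd ▸ h
  · exact (hhom fun i => i).mul (isWeightedHomogeneous_monomial _ _ _ rfl)

/-- Polarization turns the rewriting of powers of `u(x_j)` into one of monomials that have degree
at least `q (n - j)` in the `j`-th block. -/
theorem monomial_mem_of_le_degree_block {m q d W : ℕ} (hq : 0 < q)
    (hfac : (n.factorial : K) ≠ 0) (j : Fin n)
    (ih : ∀ f : CoordRing K n m, ∀ W' < W, f.IsHomogeneous d → IsBlockHomogeneous f W' →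
      f ∈ hilbertIdeal (monomialGroup K n q) m)
    {b : Fin m × Fin n →₀ ℕ} (hd : b.degree = d)
    (hW : Finsupp.weight (fun p : Fin m × Fin n => (p.2 : ℕ)) b = W)
    (hj : q * (n - j) ≤ ∑ i, b (i, j)) :
    monomial b (1 : K) ∈ hilbertIdeal (monomialGroup K n q) m := by
  have hinj : Function.Injective fun i : Fin m => (i, j) := fun _ _ h => (Prod.mk.inj h).1
  let c : Fin m →₀ ℕ := Finsupp.equivFunOnFinite.symm fun i => b (i, j)
  have hc : c.degree = ∑ i, b (i, j) := by rw [Finsupp.degree_eq_sum]; rfl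
  obtain ⟨w, hw, hwc⟩ := exists_sum_le_of_mul_le_degree q (n - j) c (hc ▸ hj)
  have hle : (∑ l, w l).mapDomain (fun i : Fin m => (i, j)) ≤ b := by
    intro p
    by_cases hp : p.2 = j
    · obtain ⟨i, l⟩ := p
      obtain rfl : l = j := hp
      rw [Finsupp.mapDomain_apply hinj (∑ l, w l) i]
      exact hwc i
    · rw [Finsupp.mapDomain_of_notMem_range]
      · exact Nat.zero_le _
      · rintro ⟨i, rfl⟩
        exact hp rfl
  obtain ⟨b', rfl⟩ := exists_add_of_le hle
  have hdeg : (∑ l, w l).degree = q * (n - j) := by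
    rw [map_sum, Finset.sum_congr rfl fun l _ => hw l]
    simp [mul_comm]
  have hmap : ∀ v : Fin n → ℕ, Finsupp.weight (fun p : Fin m × Fin n => v p.2)
      ((∑ l, w l).mapDomain (fun i : Fin m => (i, j))) = q * (n - j) * v j := by
    intro v
    rw [weight_mapDomain_block, hdeg]
  have hpow : ∀ u : MvPolynomial (Fin m) K, u.IsHomogeneous q →
      blockEval j u ^ (n - j : ℕ) * monomial b' 1 ∈ hilbertIdeal (monomialGroup K n q) m := by
    intro u hu
    refine blockEval_pow_mul_mem hq j ih hu ?_ ?_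
    · have h := hmap fun _ => 1
      rw [mul_one] at h
      rw [← hd, map_add, ← h, Finsupp.degree_eq_weight_one]
    · rw [← hW, map_add, hmap fun i => i, mul_assoc]
  let p : Fin (n - j) → MvPolynomial (Fin m) K := fun l => monomial (w l) 1
  have hprod : monomial ((∑ l, w l).mapDomain (fun i : Fin m => (i, j)) + b') (1 : K) =
      blockEval j (∏ l, p l) * monomial b' 1 := by
    rw [← monomial_sum_one, blockEval, rename_monomial, monomial_mul, one_mul]
  have hk : ((n - j : ℕ).factorial : K) ≠ 0 := by
    obtain ⟨c, hc⟩ := Nat.factorial_dvd_factorial (Nat.sub_le n j)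
    intro h0
    rw [hc, Nat.cast_mul, h0, zero_mul] at hfac
    exact hfac rfl
  have hmem : C ((n - j : ℕ).factorial : K) * (blockEval j (∏ l, p l) * monomial b' 1) ∈
      hilbertIdeal (monomialGroup K n q) m := by
    have h := congrArg (blockEval (m := m) j) (factorial_smul_prod_eq_sum_pow p)
    rw [map_mul, map_natCast] at h
    rw [← mul_assoc, map_natCast, h, map_sum, Finset.sum_mul]
    refine Ideal.sum_mem _ fun S _ => ?_
    rw [map_mul, map_pow _ (∑ i ∈ S, p i), mul_assoc]
    refine Ideal.mul_mem_left _ _ (hpow _ (IsHomogeneous.sum _ _ _ fun l _ => ?_))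
    exact isHomogeneous_monomial _ (hw l)
  rw [hprod]
  have h := Ideal.mul_mem_left _ (C ((n - j : ℕ).factorial : K)⁻¹) hmem
  rwa [← mul_assoc, ← C_mul, inv_mul_cancel₀ hk, C_1, one_mul] at h

theorem monomial_mem_hilbertIdeal {m q d : ℕ} (hq : 0 < q) (hfac : (n.factorial : K) ≠ 0)
    (hd : ∑ j : Fin n, (q * (n - j) - 1) < d) (W : ℕ) (b : Fin m × Fin n →₀ ℕ)
    (hb : b.degree = d) (hW : Finsupp.weight (fun p : Fin m × Fin n => (p.2 : ℕ)) b = W) :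
    monomial b (1 : K) ∈ hilbertIdeal (monomialGroup K n q) m := by
  induction W using Nat.strong_induction_on generalizing b with
  | _ W ih =>
    -- The degree bound leaves a block in which the monomial is not yet reduced.
    obtain ⟨j, hj⟩ : ∃ j : Fin n, q * (n - j) ≤ ∑ i, b (i, j) := by
      by_contra! hcon
      refine absurd hd (not_lt.2 ?_)
      rw [← hb, Finsupp.degree_eq_sum, Fintype.sum_prod_type_right]
      exact Finset.sum_le_sum fun j _ => Nat.le_sub_one_of_lt (hcon j)
    exact monomial_mem_of_le_degree_block hq hfac j
      (fun f W' hW' hf hfW => mem_of_forall_monomial_mem (fun b' => ih W' hW' b') hf hfW) hb hW hj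

theorem mem_hilbertIdeal_of_isHomogeneous {m q d : ℕ} (hq : 0 < q) (hfac : (n.factorial : K) ≠ 0)
    (hd : ∑ j : Fin n, (q * (n - j) - 1) < d) {f : CoordRing K n m} (hf : f.IsHomogeneous d) :
    f ∈ hilbertIdeal (monomialGroup K n q) m := by
  rw [f.as_sum]
  refine Ideal.sum_mem _ fun b hb => ?_
  rw [← mul_one (coeff b f), ← C_mul_monomial]
  refine Ideal.mul_mem_left _ _ (monomial_mem_hilbertIdeal hq hfac hd _ b ?_ rfl)
  rw [Finsupp.degree_eq_weight_one]
  exact hf (mem_support_iff.1 hb)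

/-! ### A linear functional that vanishes on the Hilbert ideal -/

/-- The matrix with the entry `ε j` at position `(σ j, j)`, for each `j`, as an element of `GL`. -/
noncomputable def monomialMatrix (σ : Equiv.Perm (Fin n)) (ε : Fin n → Kˣ) : GL (Fin n) K where
  val := Matrix.of fun i j => if i = σ j then (ε j : K) else 0
  inv := Matrix.of fun i j => if σ i = j then ((ε i)⁻¹ : Kˣ) else 0
  val_inv := by
    ext i j
    rw [Matrix.mul_apply, Finset.sum_eq_single (σ.symm j)]
    · simp [Matrix.one_apply]
    · intro k _ hk
      have : σ k ≠ j := fun h => hk (by rw [← h, Equiv.symm_apply_apply])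
      simp [this]
    · simp
  inv_val := by
    ext i j
    rw [Matrix.mul_apply, Finset.sum_eq_single (σ i)]
    · by_cases h : i = j
      · subst h; simp
      · simp [h, σ.injective.ne h]
    · intro k _ hk
      simp [Ne.symm hk]
    · simp

theorem monomialMatrix_mem {q : ℕ} (σ : Equiv.Perm (Fin n)) {ε : Fin n → Kˣ}
    (hε : ∀ j, ε j ^ q = 1) : monomialMatrix σ ε ∈ monomialGroup K n q :=
  ⟨σ, ε, hε, fun _ _ => rfl⟩

theorem pullback_monomialMatrix_X {m : ℕ} (σ : Equiv.Perm (Fin n)) (ε : Fin n → Kˣ) (i : Fin m)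
    (j : Fin n) :
    pullback m (monomialMatrix σ ε) (X (i, σ j)) = C (ε j : K) * X (i, j) := by
  rw [pullback, aeval_X, Finset.sum_eq_single j]
  · simp [monomialMatrix]
  · intro k _ hk
    simp [monomialMatrix, hk.symm]
  · simp

theorem IsInvariant.coeff_perm {m q : ℕ} {h : CoordRing K n m}
    (hh : IsInvariant (monomialGroup K n q) h) (σ : Equiv.Perm (Fin n))
    (a : Fin m × Fin n →₀ ℕ) :
    coeff (a.mapDomain (Prod.map id σ)) h = coeff a h := by
  have h1 := hh _ (monomialMatrix_mem σ⁻¹ (ε := fun _ => 1) fun _ => one_pow q)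
  have h2 : pullback m (monomialMatrix (K := K) σ⁻¹ fun _ => 1) = rename (Prod.map id σ) := by
    refine algHom_ext fun p => ?_
    obtain ⟨i, j⟩ := p
    have h3 := pullback_monomialMatrix_X (K := K) σ⁻¹ (fun _ => 1) i (σ j)
    rw [show σ⁻¹ (σ j) = j from σ.symm_apply_apply j, Units.val_one, C_1, one_mul] at h3
    rw [h3, rename_X]
    rfl
  rw [h2] at h1
  conv_lhs => rw [← h1]
  exact coeff_rename_mapDomain _ (Function.injective_id.prodMap σ.injective) _ _

theorem coeff_aeval_C_mul_X {σ : Type*} (c : σ → K) (a : σ →₀ ℕ) (h : MvPolynomial σ K) :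
    coeff a (aeval (fun p => C (c p) * X p : σ → MvPolynomial σ K) h) =
      (a.prod fun p e => c p ^ e) * coeff a h := by
  classical
  induction h using MvPolynomial.induction_on' with
  | monomial b r =>
    have h1 : aeval (fun p => C (c p) * X p : σ → MvPolynomial σ K) (monomial b r) =
        monomial b ((b.prod fun p e => c p ^ e) * r) := by
      rw [aeval_monomial, monomial_eq (s := b), Finsupp.prod, Finsupp.prod, Finsupp.prod]
      simp only [mul_pow, Finset.prod_mul_distrib, C_mul, map_prod, map_pow, algebraMap_eq]
      ring
    rw [h1, coeff_monomial, coeff_monomial]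
    split_ifs with hab
    · rw [hab]
    · rw [mul_zero]
  | add f g hf hg => rw [map_add, coeff_add, hf, hg, coeff_add, mul_add]

/-- Diagonal matrices with one entry a primitive `q`-th root of unity detect the block degrees of
the monomials of an invariant. -/
theorem IsInvariant.dvd_sum_of_coeff_ne_zero {m q : ℕ} {h : CoordRing K n m}
    (hh : IsInvariant (monomialGroup K n q) h) (hq : 0 < q) {ζ : K} (hζ : IsPrimitiveRoot ζ q)
    {a : Fin m × Fin n →₀ ℕ} (ha : coeff a h ≠ 0) (j : Fin n) : q ∣ ∑ i, a (i, j) := by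
  let ε : Fin n → Kˣ := fun l => if l = j then (hζ.isUnit hq.ne').unit else 1
  have hε : ∀ l, ε l ^ q = 1 := by
    intro l
    by_cases hl : l = j
    · ext; simp [ε, hl, hζ.pow_eq_one]
    · simp [ε, hl]
  have h1 := hh _ (monomialMatrix_mem 1 hε)
  have h2 : pullback m (monomialMatrix 1 ε) = aeval fun p => C (ε p.2 : K) * X p := by
    refine algHom_ext fun p => ?_
    rw [aeval_X]
    exact pullback_monomialMatrix_X 1 ε p.1 p.2
  have h3 := coeff_aeval_C_mul_X (fun p : Fin m × Fin n => (ε p.2 : K)) a h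
  rw [← h2, h1] at h3
  have h4 := (mul_eq_right₀ ha).1 h3.symm
  rw [Finsupp.prod_fintype _ _ (by simp), Fintype.prod_prod_type_right,
    Finset.prod_eq_single j] at h4
  · simp only [ε, if_pos rfl, IsUnit.unit_spec, Finset.prod_pow_eq_pow_sum] at h4
    exact hζ.dvd_of_pow_eq_one _ h4
  · intro l _ hl
    simp [ε, hl]
  · simp

/-- The exponent vector of the monomial `∏ j, x(i₀)_j ^ (q (σ j + 1) - 1)`. -/
noncomputable def staircase {m : ℕ} (q : ℕ) (i₀ : Fin m) (σ : Equiv.Perm (Fin n)) :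
    Fin m × Fin n →₀ ℕ :=
  Finsupp.equivFunOnFinite.symm fun p => if p.1 = i₀ then q * (σ p.2 + 1) - 1 else 0

theorem staircase_apply {m : ℕ} (q : ℕ) (i₀ : Fin m) (σ : Equiv.Perm (Fin n)) (i : Fin m)
    (j : Fin n) : staircase q i₀ σ (i, j) = if i = i₀ then q * (σ j + 1) - 1 else 0 := rfl

theorem staircase_injective {m q : ℕ} (hq : 0 < q) (i₀ : Fin m) :
    Function.Injective (staircase (n := n) q i₀) := by
  intro σ τ h
  ext j
  have h1 := DFunLike.congr_fun h (i₀, j)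
  rw [staircase_apply, staircase_apply, if_pos rfl, if_pos rfl] at h1
  have h2 : ∀ x : ℕ, 0 < q * (x + 1) := fun x => Nat.mul_pos hq x.succ_pos
  have h3 : q * ((σ j : ℕ) + 1) = q * ((τ j : ℕ) + 1) := by
    have := h2 (σ j)
    have := h2 (τ j)
    omega
  exact Nat.succ_injective (Nat.eq_of_mul_eq_mul_left hq h3)

theorem degree_staircase_one {m : ℕ} (q : ℕ) (i₀ : Fin m) :
    (staircase (n := n) q i₀ 1).degree = ∑ j : Fin n, (q * (j + 1) - 1) := by
  rw [Finsupp.degree_eq_sum, Fintype.sum_prod_type, Finset.sum_eq_single i₀]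
  · exact Finset.sum_congr rfl fun j _ => by
      rw [staircase_apply, if_pos rfl, Equiv.Perm.one_apply]
  · intro i _ hi
    exact Finset.sum_eq_zero fun j _ => by rw [staircase_apply, if_neg hi]
  · simp

/-- The signed sum of the coefficients of the monomials obtained from
`∏ j, x(i₀)_j ^ (q (j + 1) - 1)` by permuting the second index. -/
noncomputable def alternatingCoeff {m : ℕ} (q : ℕ) (i₀ : Fin m) : CoordRing K n m →ₗ[K] K :=
  ∑ σ : Equiv.Perm (Fin n), ((Equiv.Perm.sign σ : ℤ) : K) • lcoeff K (staircase q i₀ σ)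

theorem alternatingCoeff_apply {m : ℕ} (q : ℕ) (i₀ : Fin m) (f : CoordRing K n m) :
    alternatingCoeff q i₀ f =
      ∑ σ : Equiv.Perm (Fin n), ((Equiv.Perm.sign σ : ℤ) : K) * coeff (staircase q i₀ σ) f := by
  simp [alternatingCoeff]

/-- If `a ≤ staircase q i₀ σ` is a proper divisor with block degrees congruent to those of the
staircase modulo `q`, then two of its exponents agree: distinct exponents would be at least as
large in total as those of the staircase. -/
theorem exists_ne_of_lt_staircase {m q : ℕ} (hq : 0 < q) {i₀ : Fin m} {σ : Equiv.Perm (Fin n)}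
    {a : Fin m × Fin n →₀ ℕ} (hle : a ≤ staircase q i₀ σ) (hne : a ≠ staircase q i₀ σ)
    (hdvd : ∀ j, q ∣ ∑ i, (staircase q i₀ σ - a) (i, j)) :
    ∃ j₁ j₂, j₁ ≠ j₂ ∧ a (i₀, j₁) = a (i₀, j₂) := by
  have hzero : ∀ i j, i ≠ i₀ → a (i, j) = 0 := by
    intro i j hi
    have := hle (i, j)
    rwa [staircase_apply, if_neg hi, Nat.le_zero] at this
  have hex : ∀ j, ∃ t : ℕ, t ≤ σ j ∧ a (i₀, j) = q * (t + 1) - 1 := by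
    intro j
    obtain ⟨s, hs⟩ := hdvd j
    rw [Finset.sum_eq_single i₀ (fun i _ hi => by
      rw [Finsupp.tsub_apply, staircase_apply, if_neg hi, Nat.zero_sub]) (by simp),
      Finsupp.tsub_apply, staircase_apply, if_pos rfl] at hs
    have h1 := hle (i₀, j)
    rw [staircase_apply, if_pos rfl] at h1
    have hpos : 0 < q * ((σ j : ℕ) + 1) := Nat.mul_pos hq (Nat.succ_pos _)
    have hslt : s ≤ σ j := by
      have h2 : q * s < q * ((σ j : ℕ) + 1) := by omega
      exact Nat.lt_succ_iff.1 (Nat.lt_of_mul_lt_mul_left h2)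
    refine ⟨σ j - s, Nat.sub_le _ _, ?_⟩
    have h3 : q * ((σ j : ℕ) - s + 1) + q * s = q * ((σ j : ℕ) + 1) := by
      rw [← mul_add]
      congr 1
      omega
    omega
  choose t ht hat using hex
  by_contra! hcon
  let T : Fin n → Fin n := fun j => ⟨t j, (ht j).trans_lt (σ j).2⟩
  have hT : Function.Injective T := by
    intro j₁ j₂ h
    by_contra hj
    apply hcon j₁ j₂ hj
    have h' : t j₁ = t j₂ := congrArg Fin.val h
    rw [hat, hat, h']
  have hsum : ∑ j, (T j : ℕ) = ∑ j, (σ j : ℕ) := by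
    rw [(Finite.injective_iff_bijective.1 hT).sum_comp (fun j : Fin n => (j : ℕ)),
      Equiv.sum_comp σ (fun j : Fin n => (j : ℕ))]
  have heq := (Finset.sum_eq_sum_iff_of_le fun j _ => ht j).1 hsum
  apply hne
  ext p
  obtain ⟨i, j⟩ := p
  rw [staircase_apply]
  split_ifs with hi
  · rw [hi, hat, heq j (Finset.mem_univ j)]
  · exact hzero i j hi

theorem alternatingCoeff_monomial_mul {m q : ℕ} (hq : 0 < q) {ζ : K} (hζ : IsPrimitiveRoot ζ q)
    (i₀ : Fin m) {h : CoordRing K n m} (hh : IsInvariant (monomialGroup K n q) h) {d : ℕ}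
    (hd : 0 < d) (hhom : h.IsHomogeneous d) (a : Fin m × Fin n →₀ ℕ) (c : K) :
    alternatingCoeff q i₀ (monomial a c * h) = 0 := by
  rw [alternatingCoeff_apply]
  by_cases hex : ∃ σ, a ≤ staircase q i₀ σ ∧ coeff (staircase q i₀ σ - a) h ≠ 0
  · obtain ⟨σ₀, hle, hne⟩ := hex
    have hne' : a ≠ staircase q i₀ σ₀ := by
      rintro rfl
      rw [tsub_self] at hne
      have := hhom hne
      rw [map_zero] at this
      exact hd.ne this
    obtain ⟨j₁, j₂, hj, haj⟩ := exists_ne_of_lt_staircase hq hle hne'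
      (hh.dvd_sum_of_coeff_ne_zero hq hζ hne)
    -- The transposition of `j₁` and `j₂` fixes `a`, hence reverses the sign of each summand.
    have hzero : ∀ i j, i ≠ i₀ → a (i, j) = 0 := by
      intro i j hi
      have := hle (i, j)
      rwa [staircase_apply, if_neg hi, Nat.le_zero] at this
    let τ := Equiv.swap j₁ j₂
    have hfix : ∀ i j, a (i, τ j) = a (i, j) := by
      intro i j
      by_cases hi : i = i₀
      · subst hi
        simp only [τ, Equiv.swap_apply_def]
        split_ifs with h1 h2
        · rw [h1, haj]
        · rw [h2, haj]
        · rfl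
      · rw [hzero _ _ hi, hzero _ _ hi]
    have hperm : ∀ σ : Equiv.Perm (Fin n), coeff (staircase q i₀ (σ * τ)) (monomial a c * h) =
        coeff (staircase q i₀ σ) (monomial a c * h) := by
      intro σ
      have happ : ∀ i j, staircase q i₀ (σ * τ) (i, j) = staircase q i₀ σ (i, τ j) :=
        fun i j => rfl
      rw [coeff_monomial_mul', coeff_monomial_mul']
      have hiff : a ≤ staircase q i₀ (σ * τ) ↔ a ≤ staircase q i₀ σ := by
        constructor
        · rintro hl ⟨i, j⟩
          have := hl (i, τ j)
          rwa [hfix, happ, Equiv.swap_apply_self] at this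
        · rintro hl ⟨i, j⟩
          have := hl (i, τ j)
          rwa [hfix] at this
      have hmap : (staircase q i₀ σ - a).mapDomain (Prod.map id τ) =
          staircase q i₀ (σ * τ) - a := by
        ext p
        obtain ⟨i, j⟩ := p
        have h1 := Finsupp.mapDomain_apply (Function.injective_id.prodMap τ.injective)
          (staircase q i₀ σ - a) (i, τ j)
        simp only [Prod.map_apply, id_eq] at h1
        rw [show τ (τ j) = j from Equiv.swap_apply_self _ _ _] at h1
        rw [h1, Finsupp.tsub_apply, Finsupp.tsub_apply, happ, hfix]
      rw [← hmap, hh.coeff_perm]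
      exact if_congr hiff rfl rfl
    refine Finset.sum_involution (fun σ _ => σ * τ) ?_ ?_ (fun _ _ => Finset.mem_univ _) ?_
    · intro σ _
      rw [hperm, Equiv.Perm.sign_mul, Equiv.Perm.sign_swap hj]
      simp
    · intro σ _ _ hστ
      have : τ j₁ = j₁ := by
        have := mul_eq_left.1 hστ
        rw [this]; rfl
      rw [Equiv.swap_apply_left] at this
      exact hj this.symm
    · intro σ _
      rw [mul_assoc, Equiv.swap_mul_self, mul_one]
  · push Not at hex
    refine Finset.sum_eq_zero fun σ _ => ?_
    rw [coeff_monomial_mul']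
    split_ifs with hl
    · rw [hex σ hl, mul_zero, mul_zero]
    · rw [mul_zero]

theorem alternatingCoeff_eq_zero {m q : ℕ} (hq : 0 < q) {ζ : K} (hζ : IsPrimitiveRoot ζ q)
    (i₀ : Fin m) {f : CoordRing K n m} (hf : f ∈ hilbertIdeal (monomialGroup K n q) m) :
    alternatingCoeff q i₀ f = 0 := by
  suffices H : ∀ g, alternatingCoeff q i₀ (g * f) = 0 by simpa using H 1
  refine Submodule.span_induction (p := fun f _ => ∀ g, alternatingCoeff q i₀ (g * f) = 0)
    ?_ ?_ ?_ ?_ hf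
  · rintro h ⟨hh, d, hd, hhom⟩ g
    rw [g.as_sum, Finset.sum_mul, map_sum]
    exact Finset.sum_eq_zero fun a _ => alternatingCoeff_monomial_mul hq hζ i₀ hh hd hhom a _
  · intro g
    rw [mul_zero, map_zero]
  · intro x y _ _ hx hy g
    rw [mul_add, map_add, hx, hy, add_zero]
  · intro r x _ hx g
    rw [smul_eq_mul, ← mul_assoc]
    exact hx _

theorem monomial_staircase_notMem {m q : ℕ} (hq : 0 < q) {ζ : K} (hζ : IsPrimitiveRoot ζ q)
    (i₀ : Fin m) :
    monomial (staircase (n := n) q i₀ 1) (1 : K) ∉ hilbertIdeal (monomialGroup K n q) m := by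
  intro hmem
  have h := alternatingCoeff_eq_zero hq hζ i₀ hmem
  rw [alternatingCoeff_apply, Finset.sum_eq_single 1] at h
  · simp at h
  · intro σ _ hσ
    rw [coeff_monomial, if_neg fun h1 => hσ (staircase_injective hq i₀ h1).symm, mul_zero]
  · simp

/-! ### The top degree of the coinvariants -/

theorem sum_Icc_eq_sum_fin (q n : ℕ) :
    ∑ j ∈ Finset.Icc 1 n, (q * j - 1) = ∑ j : Fin n, (q * (j + 1) - 1) := by
  rw [Fin.sum_univ_eq_sum_range fun j => q * (j + 1) - 1, Finset.range_eq_Ico,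
    Finset.sum_Ico_add' (fun j => q * j - 1) 0 n 1]
  rfl

theorem sum_fin_rev (q n : ℕ) :
    ∑ j : Fin n, (q * (n - j) - 1) = ∑ j : Fin n, (q * (j + 1) - 1) := by
  rw [← Equiv.sum_comp Fin.revPerm]
  refine Finset.sum_congr rfl fun j _ => ?_
  have := j.2
  rw [Fin.revPerm_apply, Fin.val_rev, show n - (n - (j + 1 : ℕ)) = j + 1 by omega]

end VectorInvariants

theorem mainTheorem5 {K : Type*} [Field K] (n q m : ℕ) (hm : 1 ≤ m)
    (hinv : IsUnit ((n.factorial * q : ℕ) : K)) (hroot : ∃ ζ : K, IsPrimitiveRoot ζ q) :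
    (∀ d : ℕ, 1 + ∑ j ∈ Finset.Icc 1 n, (q * j - 1) ≤ d →
      ∀ f : VectorInvariants.CoordRing K n m, f.IsHomogeneous d →
        f ∈ VectorInvariants.hilbertIdeal (VectorInvariants.monomialGroup K n q) m) ∧
    (∃ f : VectorInvariants.CoordRing K n m,
      f.IsHomogeneous (∑ j ∈ Finset.Icc 1 n, (q * j - 1)) ∧
        f ∉ VectorInvariants.hilbertIdeal (VectorInvariants.monomialGroup K n q) m) ∧
    VectorInvariants.tau (VectorInvariants.monomialGroup K n q) m =
      1 + ∑ j ∈ Finset.Icc 1 n, (q * j - 1) := by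
  obtain ⟨ζ, hζ⟩ := hroot
  rw [Nat.cast_mul] at hinv
  have hfac : (n.factorial : K) ≠ 0 := left_ne_zero_of_mul hinv.ne_zero
  have hq : 0 < q := Nat.pos_of_ne_zero fun h => by
    rw [h, Nat.cast_zero, mul_zero] at hinv
    exact hinv.ne_zero rfl
  have upper : ∀ d : ℕ, 1 + ∑ j ∈ Finset.Icc 1 n, (q * j - 1) ≤ d →
      ∀ f : VectorInvariants.CoordRing K n m, f.IsHomogeneous d →
        f ∈ VectorInvariants.hilbertIdeal (VectorInvariants.monomialGroup K n q) m := by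
    intro d hd f hf
    refine VectorInvariants.mem_hilbertIdeal_of_isHomogeneous hq hfac ?_ hf
    rw [VectorInvariants.sum_fin_rev, ← VectorInvariants.sum_Icc_eq_sum_fin]
    omega
  have lower : ∃ f : VectorInvariants.CoordRing K n m,
      f.IsHomogeneous (∑ j ∈ Finset.Icc 1 n, (q * j - 1)) ∧
        f ∉ VectorInvariants.hilbertIdeal (VectorInvariants.monomialGroup K n q) m := by
    refine ⟨_, MvPolynomial.isHomogeneous_monomial _ ?_,
      VectorInvariants.monomial_staircase_notMem hq hζ ⟨0, hm⟩⟩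
    rw [VectorInvariants.degree_staircase_one, VectorInvariants.sum_Icc_eq_sum_fin]
  refine ⟨upper, lower, le_antisymm (Nat.sInf_le upper) (le_csInf ⟨_, upper⟩ fun d hd => ?_)⟩
  obtain ⟨f, hf, hnot⟩ := lower
  by_contra! hlt
  exact hnot (hd _ (by omega) f hf)
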